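/- Let $N, n, p$ be non-negative integers with $n\ge 1$. For $1\le i\le N$ let $A_i, G_i\in\mathbb{R}^{n\times n}$ and $c_i\in\mathbb{R}^{n\times p}$, and for $i\ne j$ let $A_{ij}\in\mathbb{R}^{n\times n}$. Let $r_{\min}>0$ and $\sigma\in\mathbb{R}$, and put $\operatorname{Sp}[\sigma]=\{\gamma\in\mathbb{R}^N : \gamma_i\ge 0 \text{ for all } i,\ \sum_{i=1}^N\gamma_i=\sigma\}$. A pair $(F,B)$ with $F\in\mathbb{R}^{n\times n}$, $B\in\mathbb{R}^{n\times p}$ is controllable if the matrix $[B, FB,\dots,F^{n-1}B]$ has rank $n$. A pair $(F,b)$ with $b\in\mathbb{R}^{n\times p}$ is observable if the matrix with block rows $b^\top, b^\top F,\dots,b^\top F^{n-1}$ has rank $n$. For $(F,b)$ observable and $P$ positive definite, the triplet $(F,b,P)$ is regular if for some $r>0$ the pair $(F,Sb)$ is controllable, where $S$ is the positive definite solution of $FS+SF^\top-r\,Sbb^\top S+P=0$. Assume that for every $i$ the pair $(A_i,c_i)$ is observable, $G_i$ is nonsingular, and the triplet $(A_i,c_i,G_iG_i^\top)$ is regular.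 For $\epsilon\in\mathbb{R}$ let $A=A(\epsilon)$ be the $nN\times nN$ block matrix with diagonal blocks $A_i$ and off-diagonal blocks $\epsilon A_{ij}$. Let $G=\operatorname{diag}(G_1,\dots,G_N)$ and $c_\gamma=\operatorname{diag}(\sqrt{\gamma_1+r_{\min}}\,c_1,\dots,\sqrt{\gamma_N+r_{\min}}\,c_N)$. Then there is $\epsilon_0>0$ such that for every $\epsilon$ with $|\epsilon|\le\epsilon_0$ the following hold. 0. For every $\gamma\in\mathbb{R}^N$ with $\gamma_i>-r_{\min}$ for all $i$, the algebraic Riccati equation $$A\Sigma+\Sigma A^\top-\Sigma c_\gamma c_\gamma^\top\Sigma+GG^\top=0$$ has exactly one positive definite solution $\Sigma=\Sigma(\gamma)$, and the function $\eta(\gamma)=\operatorname{tr}\Sigma(\gamma)$ is differentiable at every point of $\operatorname{Sp}[\sigma]$. 1. The function $\eta$ is strictly convex on $\operatorname{Sp}[\sigma]$. 2. If $\operatorname{Sp}[\sigma]$ is non-empty, then $\eta$ has a unique minimizer on it. A point $\gamma^*\in\operatorname{Sp}[\sigma]$ is the unique minimizer of $\eta$ on $\operatorname{Sp}[\sigma]$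 if and only if there is a number $\mu\le 0$ such that $\frac{\partial\eta}{\partial\gamma_i}(\gamma^*)=\mu$ for every $i$ with $\gamma^*_i\ne 0$, and $\frac{\partial\eta}{\partial\gamma_j}(\gamma^*)\ge\mu$ for every $j$ with $\gamma^*_j=0$. -/

import Mathlib

open scoped Matrix Topology

noncomputable section

/-- The simplex `Sp[σ]` of height `σ` in `ℝ^N`. -/
def allocSimplex (N : ℕ) (σ : ℝ) : Set (Fin N → ℝ) :=
  {v | (∀ i, 0 ≤ v i) ∧ ∑ i, v i = σ}

/-- The Kalman matrix `[B, A B, …, A ^ (n - 1) B]` of the pair `(A, B)`. -/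
def controllabilityMatrix {n q : ℕ} (A : Matrix (Fin n) (Fin n) ℝ) (B : Matrix (Fin n) (Fin q) ℝ) :
    Matrix (Fin n) (Fin n × Fin q) ℝ :=
  Matrix.of fun a k => (A ^ (k.1 : ℕ) * B) a k.2

/-- The pair `(A, B)` is controllable (for the system `dx = A x dt + B u dt`). -/
def IsControllablePair {n q : ℕ} (A : Matrix (Fin n) (Fin n) ℝ) (B : Matrix (Fin n) (Fin q) ℝ) :
    Prop :=
  (controllabilityMatrix A B).rank = n

/-- The matrix with block rows `cᵀ, cᵀ A, …, cᵀ A ^ (n - 1)`. -/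
def observabilityMatrix {n p : ℕ} (A : Matrix (Fin n) (Fin n) ℝ) (c : Matrix (Fin n) (Fin p) ℝ) :
    Matrix (Fin n × Fin p) (Fin n) ℝ :=
  Matrix.of fun k a => (cᵀ * A ^ (k.1 : ℕ)) k.2 a

/-- The pair `(A, c)` is observable (for the output `cᵀ x` of `dx = A x dt`). -/
def IsObservablePair {n p : ℕ} (A : Matrix (Fin n) (Fin n) ℝ) (c : Matrix (Fin n) (Fin p) ℝ) :
    Prop :=
  (observabilityMatrix A c).rank = n

/-- `S` is a positive definite (in particular symmetric) solution of the algebraic Riccati equation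
`A S + S Aᵀ - S R S + P = 0`. -/
def IsPosDefRiccatiSolution {ι : Type*} [Fintype ι] [DecidableEq ι] (A R P S : Matrix ι ι ℝ) :
    Prop :=
  S.PosDef ∧ A * S + S * Aᵀ - S * R * S + P = 0

/-- Regularity of the triplet `(A, c, P)`, meant for `(A, c)` observable and `P` positive definite:
for some `r > 0` the pair `(A, S c)` is controllable, where `S` is the positive definite solution of
`A S + S Aᵀ - r S c cᵀ S + P = 0`. -/
def IsRegularTriplet {n p : ℕ} (A : Matrix (Fin n) (Fin n) ℝ) (c : Matrix (Fin n) (Fin p) ℝ)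
    (P : Matrix (Fin n) (Fin n) ℝ) : Prop :=
  ∃ r : ℝ, 0 < r ∧ ∃ S : Matrix (Fin n) (Fin n) ℝ,
    IsPosDefRiccatiSolution A (r • (c * cᵀ)) P S ∧ IsControllablePair A (S * c)

/-- The drift matrix of the coupled network: diagonal blocks `A i`, off-diagonal blocks
`ε • C i j`. The pair `(a, i)` is the index of coordinate `a` of subsystem `i`; the blocks `C i i`
are not used. -/
def networkDrift {N n : ℕ} (A : Fin N → Matrix (Fin n) (Fin n) ℝ)
    (C : Fin N → Fin N → Matrix (Fin n) (Fin n) ℝ) (ε : ℝ) :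
    Matrix (Fin n × Fin N) (Fin n × Fin N) ℝ :=
  Matrix.of fun x y => if x.2 = y.2 then A x.2 x.1 y.1 else ε * C x.2 y.2 x.1 y.1

/-- The observation matrix `c_γ = diag(√(γ₁ + rmin) c₁, …, √(γ_N + rmin) c_N)`. -/
def networkOutput {N n p : ℕ} (c : Fin N → Matrix (Fin n) (Fin p) ℝ) (rmin : ℝ) (γ : Fin N → ℝ) :
    Matrix (Fin n × Fin N) (Fin p × Fin N) ℝ :=
  Matrix.blockDiagonal fun i => Real.sqrt (γ i + rmin) • c i

/-- `S` is a positive definite solution of the Riccati equation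
`A S + S Aᵀ - S c_γ c_γᵀ S + G Gᵀ = 0` of the coupled network, where `G = diag(G₁, …, G_N)`. -/
def IsNetworkCovariance {N n p : ℕ} (A : Fin N → Matrix (Fin n) (Fin n) ℝ)
    (C : Fin N → Fin N → Matrix (Fin n) (Fin n) ℝ) (c : Fin N → Matrix (Fin n) (Fin p) ℝ)
    (G : Fin N → Matrix (Fin n) (Fin n) ℝ) (rmin ε : ℝ) (γ : Fin N → ℝ)
    (S : Matrix (Fin n × Fin N) (Fin n × Fin N) ℝ) : Prop :=
  IsPosDefRiccatiSolution (networkDrift A C ε)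
    (networkOutput c rmin γ * (networkOutput c rmin γ)ᵀ)
    (Matrix.blockDiagonal G * (Matrix.blockDiagonal G)ᵀ) S

open Classical in
/-- `Σ(γ)`: the positive definite solution of the network Riccati equation (`0` if there is
none). -/
def networkCovariance {N n p : ℕ} (A : Fin N → Matrix (Fin n) (Fin n) ℝ)
    (C : Fin N → Fin N → Matrix (Fin n) (Fin n) ℝ) (c : Fin N → Matrix (Fin n) (Fin p) ℝ)
    (G : Fin N → Matrix (Fin n) (Fin n) ℝ) (rmin ε : ℝ) (γ : Fin N → ℝ) :
    Matrix (Fin n × Fin N) (Fin n × Fin N) ℝ :=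
  if h : ∃ S, IsNetworkCovariance A C c G rmin ε γ S then h.choose else 0

/-- The cost `η(γ) = tr Σ(γ)`. -/
def networkCost {N n p : ℕ} (A : Fin N → Matrix (Fin n) (Fin n) ℝ)
    (C : Fin N → Fin N → Matrix (Fin n) (Fin n) ℝ) (c : Fin N → Matrix (Fin n) (Fin p) ℝ)
    (G : Fin N → Matrix (Fin n) (Fin n) ℝ) (rmin ε : ℝ) (γ : Fin N → ℝ) : ℝ :=
  (networkCovariance A C c G rmin ε γ).trace

/-- The partial derivative `∂f/∂γ_i` at `γ`. -/
def partialDerivAt {N : ℕ} (f : (Fin N → ℝ) → ℝ) (i : Fin N) (γ : Fin N → ℝ) : ℝ :=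
  deriv (fun t : ℝ => f (Function.update γ i t)) (γ i)

/-- `x` is the unique minimum of `f` over `s`. -/
def IsUniqueMinimum {α : Type*} (f : α → ℝ) (s : Set α) (x : α) : Prop :=
  x ∈ s ∧ ∀ y ∈ s, y ≠ x → f x < f y

end

/-! Pass to the inverse `Y = S⁻¹`. The Riccati equation becomes `AᵀY + YA + YPY = R`, with `P = GGᵀ`
positive definite and `R = c_γ c_γᵀ` affine in `γ`; its left side `invRiccati` is a matrix-convex
quadratic in `Y`. If `Y > 0` solves it, `K = A + PY` satisfies `KᵀY + YK = R + YPY > 0`, so `Y` is a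
Lyapunov function. Hence the linear map `D ↦ KᵀD + DK` is injective, and `KᵀD + DK ≥ 0` forces `D ≥
0` for symmetric `D`.

Everything follows from this. Comparison (`posSemidef_sub_of_invRiccati`) gives uniqueness,
monotonicity of `Y` in `R`, and concavity of `Y` in `R` (`posSemidef_sub_convexComb`). As `Y ↦ tr
Y⁻¹` is decreasing and strictly convex, `η` is decreasing and strictly convex. The inverse function
theorem gives differentiability. Existence (`exists_posDef_invRiccati_eq`) is a continuation
argument: local solvability gives openness, an a priori bound gives closedness, and observability
makes the limit positive definite.

The coupling enters only through observability, an open condition expressed by a nonzero Gramian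
determinant. The optimality conditions are those of a convex, coordinatewise decreasing function on
a simplex. -/

/-! ### Lyapunov inequalities -/

theorem Matrix.IsHermitian.exists_rayleigh_min {ι : Type*} [Fintype ι] [Nonempty ι]
    {X Y : Matrix ι ι ℝ} (hX : X.IsHermitian) (hY : Y.PosDef) :
    ∃ (l : ℝ) (v : ι → ℝ), v ≠ 0 ∧ (X - l • Y).PosSemidef ∧ (X - l • Y) *ᵥ v = 0 := by
  have hpos : ∀ v : ι → ℝ, v ≠ 0 → 0 < v ⬝ᵥ (Y *ᵥ v) := fun v hv => by
    simpa using hY.dotProduct_mulVec_pos hv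
  have hne : ∀ v ∈ Metric.sphere (0 : ι → ℝ) 1, v ≠ 0 := fun v hv h => by
    simp [h] at hv
  obtain ⟨v, hv, hmin⟩ := (isCompact_sphere (0 : ι → ℝ) 1).exists_isMinOn
    (NormedSpace.sphere_nonempty.2 zero_le_one)
    (f := fun v => (v ⬝ᵥ (X *ᵥ v)) / (v ⬝ᵥ (Y *ᵥ v)))
    (ContinuousOn.div (by fun_prop) (by fun_prop) fun v hv => (hpos v (hne v hv)).ne')
  have hv0 := hne v hv
  set l := (v ⬝ᵥ (X *ᵥ v)) / (v ⬝ᵥ (Y *ᵥ v)) with hl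
  have hpsd : (X - l • Y).PosSemidef := by
    refine Matrix.PosSemidef.of_dotProduct_mulVec_nonneg
      (hX.sub (hY.isHermitian.smul (IsSelfAdjoint.all l))) fun x => ?_
    rcases eq_or_ne x 0 with rfl | hx
    · simp
    have hnx : ‖x‖ ≠ 0 := norm_ne_zero_iff.2 hx
    have hu : ‖x‖⁻¹ • x ∈ Metric.sphere (0 : ι → ℝ) 1 := by
      simp [norm_smul, hnx]
    have h := hmin hu
    simp only [Set.mem_ofPred_eq, Matrix.mulVec_smul, smul_dotProduct, dotProduct_smul,
      smul_eq_mul] at h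
    rw [mul_div_mul_left _ _ (inv_ne_zero hnx), mul_div_mul_left _ _ (inv_ne_zero hnx),
      ← hl, le_div_iff₀ (hpos x hx)] at h
    simp only [star_trivial, Matrix.sub_mulVec, dotProduct_sub, Matrix.smul_mulVec,
      dotProduct_smul, smul_eq_mul]
    linarith
  refine ⟨l, v, hv0, hpsd, ?_⟩
  rw [← hpsd.dotProduct_mulVec_zero_iff]
  simp only [star_trivial, Matrix.sub_mulVec, dotProduct_sub, Matrix.smul_mulVec,
      dotProduct_smul, smul_eq_mul]
  rw [hl, div_mul_cancel₀ _ (hpos v hv0).ne', sub_self]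

/-- Take the least generalized eigenvalue `l` of `X` relative to `Y`, with eigenvector `v`.
Evaluated at `v`, the form `KᵀX + XK` is `l` times the form `KᵀY + YK`, so `l ≥ 0`, and `X ≥ lY`. -/
theorem Matrix.PosSemidef.of_lyapunov {ι : Type*} [Fintype ι]
    {K X Y : Matrix ι ι ℝ} (hX : X.IsHermitian) (hY : Y.PosDef)
    (hKY : (Kᵀ * Y + Y * K).PosDef) (hKX : (Kᵀ * X + X * K).PosSemidef) : X.PosSemidef := by
  cases isEmpty_or_nonempty ι
  · rw [Subsingleton.elim X 0]; exact .zero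
  obtain ⟨l, v, hv, hZ, hZv⟩ := hX.exists_rayleigh_min hY
  have hXe : X = (X - l • Y) + l • Y := by abel
  set Z := X - l • Y
  have hl : 0 ≤ l := by
    have h1 := hKX.dotProduct_mulVec_nonneg v
    have h2 := hKY.dotProduct_mulVec_pos hv
    have hvZ : v ᵥ* Z = 0 := by
      rw [← Matrix.mulVec_transpose, ← Matrix.conjTranspose_eq_transpose_of_trivial, hZ.isHermitian.eq,
        hZv]
    have e : Kᵀ * X + X * K = Kᵀ * Z + Z * K + l • (Kᵀ * Y + Y * K) := by
      rw [hXe]; simp only [mul_add, add_mul, Matrix.mul_smul, Matrix.smul_mul, smul_add]; abel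
    rw [e, Matrix.add_mulVec, Matrix.add_mulVec, ← Matrix.mulVec_mulVec, ← Matrix.mulVec_mulVec, hZv,
      Matrix.smul_mulVec, dotProduct_add, dotProduct_add] at h1
    simp only [star_trivial, Matrix.mulVec_zero, dotProduct_zero, zero_add, dotProduct_smul,
      Matrix.dotProduct_mulVec v Z, hvZ, zero_dotProduct, smul_eq_mul] at h1 h2
    exact nonneg_of_mul_nonneg_left h1 h2
  rw [hXe]
  exact hZ.add (hY.posSemidef.smul hl)

theorem Matrix.eq_zero_of_posSemidef_of_neg {ι : Type*} [Fintype ι] {X : Matrix ι ι ℝ}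
    (h : X.PosSemidef) (h' : (-X).PosSemidef) : X = 0 := by
  refine h.trace_eq_zero_iff.1 (le_antisymm ?_ h.trace_nonneg)
  simpa using h'.trace_nonneg

theorem Matrix.PosDef.eq_zero_of_conj {ι κ : Type*} [Fintype ι] [Fintype κ]
    {Y : Matrix ι ι ℝ} (hY : Y.PosDef) {D : Matrix ι κ ℝ} (h : (Dᵀ * Y * D).trace = 0) : D = 0 := by
  have hp := hY.posSemidef.conjTranspose_mul_mul_same D
  rw [Matrix.conjTranspose_eq_transpose_of_trivial] at hp
  have h0 := hp.trace_eq_zero_iff.1 h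
  refine Matrix.mulVec_injective (funext fun v => ?_)
  rw [Matrix.zero_mulVec]
  by_contra hv
  have h1 := hY.dotProduct_mulVec_pos hv
  rw [star_trivial, Matrix.mulVec_mulVec, ← Matrix.vecMul_transpose, ← Matrix.dotProduct_mulVec,
    Matrix.mulVec_mulVec, ← Matrix.mul_assoc, h0] at h1
  simp at h1

/-- `D` need not be symmetric, since the inverse function theorem is applied on the space of all
matrices. The symmetric matrix `-(DᵀY⁻¹D)` takes its place: its Lyapunov image is `KᵀY + YK`
conjugated by `Y⁻¹D`, so it is both nonnegative and nonpositive. -/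
theorem Matrix.eq_zero_of_lyapunov {ι : Type*} [Fintype ι] [DecidableEq ι]
    {K Y D : Matrix ι ι ℝ} (hY : Y.PosDef)
    (hKY : (Kᵀ * Y + Y * K).PosDef) (hD : Kᵀ * D + D * K = 0) : D = 0 := by
  have hYt : Yᵀ = Y := by
    simpa [Matrix.conjTranspose_eq_transpose_of_trivial] using hY.isHermitian.eq
  have hYi : Y * Y⁻¹ = 1 := Matrix.mul_nonsing_inv _ ((Matrix.isUnit_iff_isUnit_det _).1 hY.isUnit)
  have hYi' : Y⁻¹ * Y = 1 := Matrix.nonsing_inv_mul _ ((Matrix.isUnit_iff_isUnit_det _).1 hY.isUnit)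
  have hZ := hY.inv.posSemidef.conjTranspose_mul_mul_same D
  rw [Matrix.conjTranspose_eq_transpose_of_trivial] at hZ
  have h1 : Kᵀ * D = -(D * K) := eq_neg_of_add_eq_zero_left hD
  have h2 : Dᵀ * K = -(Kᵀ * Dᵀ) := by
    have := congrArg Matrix.transpose hD
    simp only [Matrix.transpose_add, Matrix.transpose_mul, Matrix.transpose_transpose,
      Matrix.transpose_zero] at this
    exact eq_neg_of_add_eq_zero_left this
  have hneg : (-(Dᵀ * Y⁻¹ * D)).PosSemidef := by
    refine Matrix.PosSemidef.of_lyapunov (K := K) hZ.isHermitian.neg hY hKY ?_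
    have h3 := hKY.posSemidef.conjTranspose_mul_mul_same (Y⁻¹ * D)
    rw [Matrix.conjTranspose_eq_transpose_of_trivial, Matrix.transpose_mul,
      Matrix.transpose_nonsing_inv, hYt] at h3
    convert h3 using 1
    have e1 : Kᵀ * Dᵀ = -(Dᵀ * K) := by rw [h2, neg_neg]
    have e2 : D * K = -(Kᵀ * D) := by rw [h1, neg_neg]
    calc Kᵀ * -(Dᵀ * Y⁻¹ * D) + -(Dᵀ * Y⁻¹ * D) * K
        = -((Kᵀ * Dᵀ) * Y⁻¹ * D) - Dᵀ * Y⁻¹ * (D * K) := by noncomm_ring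
      _ = Dᵀ * K * Y⁻¹ * D + Dᵀ * Y⁻¹ * Kᵀ * D := by rw [e1, e2]; noncomm_ring
      _ = Dᵀ * Y⁻¹ * Kᵀ * (Y * Y⁻¹) * D + Dᵀ * (Y⁻¹ * Y) * K * Y⁻¹ * D := by
        rw [hYi, hYi']; noncomm_ring
      _ = _ := by noncomm_ring
  have := Matrix.eq_zero_of_posSemidef_of_neg hZ hneg
  exact hY.inv.eq_zero_of_conj (by rw [this, Matrix.trace_zero])

/-! ### The Riccati equation for the inverse: comparison and uniqueness -/

/-- The left-hand side of the Riccati equation `AᵀY + YA + YPY = R` satisfied by the inverse of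
a solution of `AS + SAᵀ - SRS + P = 0`. -/
def invRiccati {ι : Type*} [Fintype ι] (A P Y : Matrix ι ι ℝ) : Matrix ι ι ℝ :=
  Aᵀ * Y + Y * A + Y * P * Y

theorem transpose_invRiccati {ι : Type*} [Fintype ι] {A P : Matrix ι ι ℝ} (hP : Pᵀ = P)
    (Y : Matrix ι ι ℝ) : (invRiccati A P Y)ᵀ = invRiccati A P Yᵀ := by
  simp only [invRiccati, Matrix.transpose_add, Matrix.transpose_mul, Matrix.transpose_transpose, hP,
    mul_assoc]
  abel

theorem Matrix.IsHermitian.transpose_eq {ι : Type*} {Y : Matrix ι ι ℝ} (hY : Y.IsHermitian) :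
    Yᵀ = Y := by
  simpa [Matrix.conjTranspose_eq_transpose_of_trivial] using hY.eq

/-- The closed-loop matrix `A + PY` is antistable, with Lyapunov function `Y`. -/
theorem posDef_lyapunov_closedLoop {ι : Type*} [Fintype ι] [DecidableEq ι] {A P Y : Matrix ι ι ℝ}
    (hP : P.PosDef) (hY : Y.PosDef) (hR : (invRiccati A P Y).PosSemidef) :
    ((A + P * Y)ᵀ * Y + Y * (A + P * Y)).PosDef := by
  have h := hP.conjTranspose_mul_mul_same (B := Y)
    (Matrix.mulVec_injective_iff_isUnit.2 hY.isUnit)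
  rw [Matrix.conjTranspose_eq_transpose_of_trivial, hY.isHermitian.transpose_eq] at h
  -- The Lyapunov image of `Y` is `invRiccati A P Y + YPY`.
  convert Matrix.PosDef.posSemidef_add hR h using 1
  rw [invRiccati, Matrix.transpose_add, Matrix.transpose_mul, hY.isHermitian.transpose_eq,
    hP.isHermitian.transpose_eq]
  noncomm_ring

/-- With `K = A + PY`, the Lyapunov image of `Y - Z` is the difference of the two `invRiccati`
values plus `(Y - Z)P(Y - Z)`. Only the closed loop of `Y` matters, so `Z` may be indefinite. -/
theorem posSemidef_sub_of_invRiccati {ι : Type*} [Fintype ι] [DecidableEq ι]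
    {A P Y Z : Matrix ι ι ℝ} (hP : P.PosDef) (hY : Y.PosDef) (hZ : Z.IsHermitian)
    (hR : (invRiccati A P Y).PosSemidef) (h : (invRiccati A P Y - invRiccati A P Z).PosSemidef) :
    (Y - Z).PosSemidef := by
  have hD := hY.isHermitian.sub hZ
  refine .of_lyapunov hD hY (posDef_lyapunov_closedLoop hP hY hR) ?_
  have h1 := hP.posSemidef.conjTranspose_mul_mul_same (Y - Z)
  rw [Matrix.conjTranspose_eq_transpose_of_trivial, hD.transpose_eq] at h1
  convert h.add h1 using 1
  rw [invRiccati, invRiccati, Matrix.transpose_add, Matrix.transpose_mul,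
    hY.isHermitian.transpose_eq, hP.isHermitian.transpose_eq]
  noncomm_ring

theorem invRiccati_injective {ι : Type*} [Fintype ι] [DecidableEq ι]
    {A P Y Z : Matrix ι ι ℝ} (hP : P.PosDef) (hY : Y.PosDef) (hZ : Z.PosDef)
    (hR : (invRiccati A P Y).PosSemidef) (h : invRiccati A P Y = invRiccati A P Z) : Y = Z := by
  have h1 := posSemidef_sub_of_invRiccati hP hY hZ.isHermitian hR (by
    rw [h, sub_self]; exact .zero)
  have h2 := posSemidef_sub_of_invRiccati hP hZ hY.isHermitian (h ▸ hR) (by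
    rw [h, sub_self]; exact .zero)
  exact sub_eq_zero.1 (Matrix.eq_zero_of_posSemidef_of_neg h1 (by rwa [neg_sub]))

theorem isPosDefRiccatiSolution_iff {ι : Type*} [Fintype ι] [DecidableEq ι]
    {A R P S : Matrix ι ι ℝ} :
    IsPosDefRiccatiSolution A R P S ↔ S⁻¹.PosDef ∧ invRiccati A P S⁻¹ = R := by
  rw [IsPosDefRiccatiSolution, Matrix.posDef_inv_iff]
  refine and_congr_right fun hS => ?_
  have h1 : S * S⁻¹ = 1 := Matrix.mul_nonsing_inv _ ((Matrix.isUnit_iff_isUnit_det _).1 hS.isUnit)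
  have h2 : S⁻¹ * S = 1 := Matrix.nonsing_inv_mul _ ((Matrix.isUnit_iff_isUnit_det _).1 hS.isUnit)
  have e1 : A * S + S * Aᵀ - S * R * S + P = S * (invRiccati A P S⁻¹ - R) * S := by
    calc _ = (S * S⁻¹) * A * S + S * Aᵀ * (S⁻¹ * S) - S * R * S + (S * S⁻¹) * P * (S⁻¹ * S) := by
          rw [h1, h2]; noncomm_ring
      _ = _ := by rw [invRiccati]; noncomm_ring
  rw [e1]
  constructor
  · intro h
    have : S⁻¹ * (S * (invRiccati A P S⁻¹ - R) * S) * S⁻¹ = 0 := by rw [h]; simp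
    rw [show S⁻¹ * (S * (invRiccati A P S⁻¹ - R) * S) * S⁻¹ =
      (S⁻¹ * S) * (invRiccati A P S⁻¹ - R) * (S * S⁻¹) by noncomm_ring, h1, h2, one_mul,
      mul_one] at this
    exact sub_eq_zero.1 this
  · intro h
    rw [h]; simp

/-! ### Monotonicity and strict convexity of the trace of the inverse -/

/-- First-order expansion of `Y ↦ tr Y⁻¹` at `Z` with exact remainder; the remainder is nonnegative
and vanishes only for `Y = Z`. -/
theorem trace_inv_eq_add {ι : Type*} [Fintype ι] [DecidableEq ι] {Y Z : Matrix ι ι ℝ}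
    (hY : Y.PosDef) (hZ : Z.PosDef) :
    Y⁻¹.trace = 2 * Z⁻¹.trace - (Z⁻¹ * Y * Z⁻¹).trace
      + ((Y⁻¹ - Z⁻¹)ᵀ * Y * (Y⁻¹ - Z⁻¹)).trace := by
  have h1 : Y * Y⁻¹ = 1 := Matrix.mul_nonsing_inv _ ((Matrix.isUnit_iff_isUnit_det _).1 hY.isUnit)
  have h2 : Y⁻¹ * Y = 1 := Matrix.nonsing_inv_mul _ ((Matrix.isUnit_iff_isUnit_det _).1 hY.isUnit)
  rw [(hY.inv.isHermitian.sub hZ.inv.isHermitian).transpose_eq]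
  have : (Y⁻¹ - Z⁻¹) * Y * (Y⁻¹ - Z⁻¹) = Y⁻¹ - Z⁻¹ - Z⁻¹ + Z⁻¹ * Y * Z⁻¹ := by
    calc _ = Y⁻¹ * (Y * Y⁻¹) - (Y⁻¹ * Y) * Z⁻¹ - Z⁻¹ * (Y * Y⁻¹) + Z⁻¹ * Y * Z⁻¹ := by noncomm_ring
      _ = _ := by rw [h1, h2, mul_one, one_mul, mul_one]
  rw [this, Matrix.trace_add, Matrix.trace_sub, Matrix.trace_sub]
  ring

theorem le_trace_inv {ι : Type*} [Fintype ι] [DecidableEq ι] {Y Z : Matrix ι ι ℝ}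
    (hY : Y.PosDef) (hZ : Z.PosDef) :
    2 * Z⁻¹.trace - (Z⁻¹ * Y * Z⁻¹).trace ≤ Y⁻¹.trace := by
  have h := (hY.posSemidef.conjTranspose_mul_mul_same (Y⁻¹ - Z⁻¹)).trace_nonneg
  rw [Matrix.conjTranspose_eq_transpose_of_trivial] at h
  linarith [trace_inv_eq_add hY hZ]

theorem lt_trace_inv {ι : Type*} [Fintype ι] [DecidableEq ι] {Y Z : Matrix ι ι ℝ}
    (hY : Y.PosDef) (hZ : Z.PosDef) (hYZ : Y ≠ Z) :
    2 * Z⁻¹.trace - (Z⁻¹ * Y * Z⁻¹).trace < Y⁻¹.trace := by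
  refine (le_trace_inv hY hZ).lt_of_ne fun h => hYZ ?_
  have h0 := hY.eq_zero_of_conj (D := Y⁻¹ - Z⁻¹) (by linarith [trace_inv_eq_add hY hZ])
  exact Matrix.inv_inj (sub_eq_zero.1 h0) ((Matrix.isUnit_iff_isUnit_det _).1 hY.isUnit)

theorem trace_conj_inv_le {ι : Type*} [Fintype ι] [DecidableEq ι] {Y Z : Matrix ι ι ℝ}
    (hZ : Z.PosDef) (h : (Z - Y).PosSemidef) : (Z⁻¹ * Y * Z⁻¹).trace ≤ Z⁻¹.trace := by
  have h1 : Z * Z⁻¹ = 1 := Matrix.mul_nonsing_inv _ ((Matrix.isUnit_iff_isUnit_det _).1 hZ.isUnit)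
  have h2 := (h.conjTranspose_mul_mul_same Z⁻¹).trace_nonneg
  rw [Matrix.conjTranspose_eq_transpose_of_trivial, hZ.inv.isHermitian.transpose_eq, mul_sub, sub_mul,
    mul_assoc, h1, mul_one, Matrix.trace_sub] at h2
  linarith

theorem trace_inv_antitone {ι : Type*} [Fintype ι] [DecidableEq ι] {Y Z : Matrix ι ι ℝ}
    (hY : Y.PosDef) (hZ : Z.PosDef) (h : (Z - Y).PosSemidef) : Z⁻¹.trace ≤ Y⁻¹.trace := by
  linarith [le_trace_inv hY hZ, trace_conj_inv_le hZ h]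

theorem trace_inv_lt_of_posSemidef_sub_convexComb {ι : Type*} [Fintype ι] [DecidableEq ι]
    {Y₁ Y₂ Z : Matrix ι ι ℝ} (h₁ : Y₁.PosDef) (h₂ : Y₂.PosDef) (hZ : Z.PosDef) (hne : Y₁ ≠ Y₂)
    {s t : ℝ} (hs : 0 < s) (ht : 0 < t) (hst : s + t = 1)
    (h : (Z - (s • Y₁ + t • Y₂)).PosSemidef) :
    Z⁻¹.trace < s * Y₁⁻¹.trace + t * Y₂⁻¹.trace := by
  have h3 := trace_conj_inv_le hZ h
  simp only [mul_add, add_mul, Matrix.mul_smul, Matrix.smul_mul, Matrix.trace_add,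
    Matrix.trace_smul, smul_eq_mul] at h3
  have key : s * (2 * Z⁻¹.trace - (Z⁻¹ * Y₁ * Z⁻¹).trace)
      + t * (2 * Z⁻¹.trace - (Z⁻¹ * Y₂ * Z⁻¹).trace) < s * Y₁⁻¹.trace + t * Y₂⁻¹.trace := by
    -- `Y₁` and `Y₂` cannot both equal `Z`, so one of the two tangent inequalities at `Z` is strict.
    by_cases e : Y₁ = Z
    · have := mul_lt_mul_of_pos_left (lt_trace_inv h₂ hZ (fun e' => hne (e.trans e'.symm))) ht
      have := mul_le_mul_of_nonneg_left (le_trace_inv h₁ hZ) hs.le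
      linarith
    · have := mul_lt_mul_of_pos_left (lt_trace_inv h₁ hZ e) hs
      have := mul_le_mul_of_nonneg_left (le_trace_inv h₂ hZ) ht.le
      linarith
  have e : s * (2 * Z⁻¹.trace) + t * (2 * Z⁻¹.trace) = 2 * Z⁻¹.trace := by
    rw [← add_mul, hst, one_mul]
  linarith

/-- Concavity of the inverse Riccati solution in the observation term. -/
theorem posSemidef_sub_convexComb {ι : Type*} [Fintype ι] [DecidableEq ι]
    {A P Y₁ Y₂ Z : Matrix ι ι ℝ} (hP : P.PosDef) (h₁ : Y₁.IsHermitian) (h₂ : Y₂.IsHermitian)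
    (hZ : Z.PosDef) {s t : ℝ} (hs : 0 ≤ s) (ht : 0 ≤ t) (hst : s + t = 1)
    (hR : (invRiccati A P Z).PosSemidef)
    (h : invRiccati A P Z = s • invRiccati A P Y₁ + t • invRiccati A P Y₂) :
    (Z - (s • Y₁ + t • Y₂)).PosSemidef := by
  refine posSemidef_sub_of_invRiccati hP hZ
    ((h₁.smul (IsSelfAdjoint.all s)).add (h₂.smul (IsSelfAdjoint.all t))) hR ?_
  -- The convexity defect of the quadratic map `invRiccati A P` is exactly `s t (Y₁ - Y₂)P(Y₁ -
  -- Y₂)`.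
  have h3 := (hP.posSemidef.conjTranspose_mul_mul_same (Y₁ - Y₂)).smul (mul_nonneg hs ht)
  rw [Matrix.conjTranspose_eq_transpose_of_trivial, (h₁.sub h₂).transpose_eq] at h3
  convert h3 using 1
  rw [h]
  obtain rfl : t = 1 - s := by linarith
  simp only [invRiccati, mul_add, add_mul, mul_sub, sub_mul, Matrix.mul_smul, Matrix.smul_mul,
    smul_add, smul_sub]
  module

/-! ### Local solvability by the inverse function theorem -/

theorem Matrix.PosDef.eventually_posDef {ι : Type*} [Fintype ι] {Y : Matrix ι ι ℝ}
    (hY : Y.PosDef) : ∀ᶠ Z in 𝓝 Y, Z.IsHermitian → Z.PosDef := by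
  have hev : ∀ᶠ Z in 𝓝 Y, ∀ v ∈ Metric.sphere (0 : ι → ℝ) 1, 0 < v ⬝ᵥ (Z *ᵥ v) := by
    refine (isCompact_sphere (0 : ι → ℝ) 1).eventually_forall_of_forall_eventually fun v hv => ?_
    have hv0 : v ≠ 0 := fun h => by simp [h] at hv
    have hc : Continuous fun z : Matrix ι ι ℝ × (ι → ℝ) => z.2 ⬝ᵥ (z.1 *ᵥ z.2) := by fun_prop
    exact hc.continuousAt.eventually (lt_mem_nhds (by simpa using hY.dotProduct_mulVec_pos hv0))
  filter_upwards [hev] with Z hZ hZh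
  refine .of_dotProduct_mulVec_pos hZh fun x hx => ?_
  have hnx : ‖x‖ ≠ 0 := norm_ne_zero_iff.2 hx
  have h := hZ (‖x‖⁻¹ • x) (by simp [norm_smul, hnx])
  simp only [Matrix.mulVec_smul, smul_dotProduct, dotProduct_smul, smul_eq_mul] at h
  have hp : 0 < ‖x‖⁻¹ := inv_pos.2 (norm_pos_iff.2 hx)
  exact pos_of_mul_pos_right (pos_of_mul_pos_right h hp.le) hp.le

section LocalSolution

attribute [local instance] Matrix.linftyOpNormedRing Matrix.linftyOpNormedAlgebra

theorem exists_differentiableAt_local_invRiccati_solution {ι : Type*} [Fintype ι] [DecidableEq ι]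
    {A P Y : Matrix ι ι ℝ} (hP : P.PosDef) (hY : Y.PosDef) (hR : (invRiccati A P Y).PosSemidef) :
    ∃ g : Matrix ι ι ℝ → Matrix ι ι ℝ, DifferentiableAt ℝ g (invRiccati A P Y) ∧
      g (invRiccati A P Y) = Y ∧
      ∀ᶠ R in 𝓝 (invRiccati A P Y), R.IsHermitian → (g R).PosDef ∧ invRiccati A P (g R) = R := by
  have hK := posDef_lyapunov_closedLoop hP hY hR
  set K := A + P * Y with hKdef
  let L : Matrix ι ι ℝ →ₗ[ℝ] Matrix ι ι ℝ := LinearMap.mulLeft ℝ Kᵀ + LinearMap.mulRight ℝ K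
  have hLinj : Function.Injective L := by
    rw [injective_iff_map_eq_zero]
    exact fun D hD => Matrix.eq_zero_of_lyapunov hY hK hD
  let e : Matrix ι ι ℝ ≃L[ℝ] Matrix ι ι ℝ :=
    (LinearEquiv.ofInjectiveEndo L hLinj).toContinuousLinearEquiv
  have hYt := hY.isHermitian.transpose_eq
  have hPt := hP.isHermitian.transpose_eq
  have hd : HasStrictFDerivAt (invRiccati A P) (e : Matrix ι ι ℝ →L[ℝ] Matrix ι ι ℝ) Y := by
    have h0 := hasStrictFDerivAt_id (𝕜 := ℝ) Y
    have h1 := (((hasStrictFDerivAt_const Aᵀ Y).mul' h0).add (h0.mul' (hasStrictFDerivAt_const A Y))).add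
      ((h0.mul' (hasStrictFDerivAt_const P Y)).mul' h0)
    refine h1.congr_fderiv ?_
    ext1 D
    change Aᵀ * D + 0 * Y + (Y * 0 + D * A) + (Y * P * D + (Y * 0 + D * P) * Y) = Kᵀ * D + D * K
    rw [hKdef, Matrix.transpose_add, Matrix.transpose_mul, hYt, hPt]
    noncomm_ring
  have hleft := hd.eventually_left_inverse
  have hright := hd.eventually_right_inverse
  have htend := hd.localInverse_tendsto
  set g := hd.localInverse _ _ _ with hg
  refine ⟨g, hd.to_localInverse.differentiableAt, hd.localInverse_apply_image, ?_⟩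
  -- Symmetry of `g R`: for symmetric `R` its transpose solves the same equation and is also close
  -- to `Y`, so local injectivity identifies the two.
  have htendT : Filter.Tendsto (fun R => (g R)ᵀ) (𝓝 (invRiccati A P Y)) (𝓝 Y) := by
    have := (continuous_id.matrix_transpose.tendsto Y).comp htend
    rw [id, hYt] at this
    exact this
  filter_upwards [hright, htend.eventually hY.eventually_posDef, htendT.eventually hleft]
    with R h1 h2 h3 hRh
  rw [← transpose_invRiccati hPt, h1, hRh.transpose_eq] at h3
  exact ⟨h2 (by rw [Matrix.IsHermitian, Matrix.conjTranspose_eq_transpose_of_trivial, ← h3]), h1⟩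

end LocalSolution

/-! ### Global existence by continuation -/

theorem exists_smul_one_posSemidef_sub {ι : Type*} [Fintype ι] [DecidableEq ι] {P : Matrix ι ι ℝ}
    (hP : P.PosDef) : ∃ q : ℝ, 0 < q ∧ (P - q • (1 : Matrix ι ι ℝ)).PosSemidef := by
  cases isEmpty_or_nonempty ι
  · exact ⟨1, one_pos, by rw [Subsingleton.elim (P - _) 0]; exact .zero⟩
  obtain ⟨l, v, hv, h1, h2⟩ := hP.isHermitian.exists_rayleigh_min Matrix.PosDef.one
  refine ⟨l, ?_, h1⟩
  have h3 := hP.dotProduct_mulVec_pos hv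
  rw [Matrix.sub_mulVec, sub_eq_zero, Matrix.smul_mulVec, Matrix.one_mulVec] at h2
  rw [h2, dotProduct_smul, smul_eq_mul] at h3
  exact pos_of_mul_pos_left h3 (dotProduct_star_self_nonneg v)

/-- Solutions of the inverse Riccati equation are bounded in terms of the trace of its right-hand
side. -/
theorem exists_bound_of_trace_invRiccati_le {ι : Type*} [Fintype ι] [DecidableEq ι]
    {P : Matrix ι ι ℝ} (A : Matrix ι ι ℝ) (hP : P.PosDef) (r : ℝ) :
    ∃ b : ℝ, ∀ Y : Matrix ι ι ℝ, Y.IsHermitian → (invRiccati A P Y).trace ≤ r →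
      ∀ i j, Y i j ∈ Set.Icc (-b) b := by
  obtain ⟨q, hq, hPq⟩ := exists_smul_one_posSemidef_sub hP
  refine ⟨√((r + 2 / q * ∑ i, ∑ j, A i j ^ 2) * (2 / q)), fun Y hY hr i j => ?_⟩
  have hYt := hY.transpose_eq
  have h1 := (hPq.conjTranspose_mul_mul_same Y).trace_nonneg
  rw [Matrix.conjTranspose_eq_transpose_of_trivial, hYt, mul_sub, sub_mul, Matrix.mul_smul, mul_one,
    Matrix.smul_mul, Matrix.trace_sub, Matrix.trace_smul, smul_eq_mul] at h1
  have hYY : (Y * Y).trace = ∑ i, ∑ j, Y i j ^ 2 := by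
    nth_rewrite 2 [← hYt]
    simp [Matrix.trace, Matrix.mul_apply, pow_two]
  have hAY : (Y * A).trace = ∑ i, ∑ j, A i j * Y i j := by
    nth_rewrite 1 [← hYt]
    rw [Matrix.trace_mul_comm]
    simp [Matrix.trace, Matrix.mul_apply]
  have hAY' : (Aᵀ * Y).trace = ∑ i, ∑ j, A i j * Y i j := by
    rw [← hAY, ← Matrix.trace_transpose, Matrix.transpose_mul, Matrix.transpose_transpose, hYt]
  rw [invRiccati, Matrix.trace_add, Matrix.trace_add, hAY, hAY'] at hr
  -- Young's inequality, weighted so that the linear terms use up half of the coercive term `q tr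
  -- Y²` coming from `P ≥ q`.
  have h2 : -(2 * ∑ i, ∑ j, A i j * Y i j) ≤
      q / 2 * (∑ i, ∑ j, Y i j ^ 2) + 2 / q * ∑ i, ∑ j, A i j ^ 2 := by
    simp only [Finset.mul_sum, ← Finset.sum_neg_distrib, ← Finset.sum_add_distrib]
    refine Finset.sum_le_sum fun i _ => Finset.sum_le_sum fun j _ => ?_
    have : q / 2 * Y i j ^ 2 + 2 / q * A i j ^ 2 - -(2 * (A i j * Y i j))
        = q / 2 * (Y i j + 2 / q * A i j) ^ 2 := by field_simp; ring
    have h0 : 0 ≤ q / 2 * (Y i j + 2 / q * A i j) ^ 2 := by positivity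
    linarith
  have h3 : Y i j ^ 2 ≤ ∑ i, ∑ j, Y i j ^ 2 :=
    (Finset.single_le_sum (f := fun j => Y i j ^ 2) (fun _ _ => sq_nonneg _)
      (Finset.mem_univ j)).trans
    (Finset.single_le_sum (f := fun i => ∑ j, Y i j ^ 2)
      (fun _ _ => Finset.sum_nonneg fun _ _ => sq_nonneg _) (Finset.mem_univ i))
  rw [hYY] at h1
  refine abs_le.1 (Real.abs_le_sqrt (h3.trans ?_))
  have h4 : q / 2 * (∑ i, ∑ j, Y i j ^ 2) ≤ r + 2 / q * ∑ i, ∑ j, A i j ^ 2 := by linarith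
  calc (∑ i, ∑ j, Y i j ^ 2) = (q / 2 * (∑ i, ∑ j, Y i j ^ 2)) * (2 / q) := by field_simp
    _ ≤ _ := mul_le_mul_of_nonneg_right h4 (by positivity)

/-- Observability of `(A, R)`, in the form that the unobservable subspace vanishes. -/
def NoUnobservable {ι : Type*} [Fintype ι] [DecidableEq ι] (A R : Matrix ι ι ℝ) : Prop :=
  ∀ v : ι → ℝ, (∀ k : ℕ, R *ᵥ ((A ^ k) *ᵥ v) = 0) → v = 0

/-- The equation makes the kernel of `Y` invariant under `A` and contained in the kernel of `R`,
hence unobservable. -/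
theorem posDef_of_noUnobservable {ι : Type*} [Fintype ι] [DecidableEq ι] {A P R Y : Matrix ι ι ℝ}
    (hR : R.PosSemidef) (hobs : NoUnobservable A R) (hY : Y.PosSemidef) (h : invRiccati A P Y = R) :
    Y.PosDef := by
  have hker : ∀ v, Y *ᵥ v = 0 → R *ᵥ v = 0 ∧ Y *ᵥ (A *ᵥ v) = 0 := by
    intro v hv
    have hvY : v ᵥ* Y = 0 := by
      rw [← Matrix.mulVec_transpose, hY.isHermitian.transpose_eq, hv]
    have h0 : R *ᵥ v = 0 := by
      rw [← hR.dotProduct_mulVec_zero_iff, ← h, invRiccati]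
      simp only [Matrix.add_mulVec, ← Matrix.mulVec_mulVec, hv, Matrix.mulVec_zero, star_trivial,
        zero_add, add_zero]
      rw [Matrix.dotProduct_mulVec, hvY, zero_dotProduct]
    refine ⟨h0, ?_⟩
    rw [← h, invRiccati] at h0
    simpa only [Matrix.add_mulVec, ← Matrix.mulVec_mulVec, hv, Matrix.mulVec_zero,
        zero_add, add_zero] using h0
  refine .of_dotProduct_mulVec_pos hY.isHermitian fun v hv => ?_
  refine (hY.dotProduct_mulVec_nonneg v).lt_of_ne fun h0 => hv (hobs v fun k => ?_)
  have hk : ∀ k : ℕ, Y *ᵥ ((A ^ k) *ᵥ v) = 0 := by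
    intro k
    induction k with
    | zero => simpa using (hY.dotProduct_mulVec_zero_iff v).1 h0.symm
    | succ k ih =>
      rw [pow_succ', ← Matrix.mulVec_mulVec]
      exact (hker _ ih).2
  exact (hker _ (hk k)).1

theorem isClosed_setOf_posSemidef {ι : Type*} [Fintype ι] :
    IsClosed {Y : Matrix ι ι ℝ | Y.PosSemidef} := by
  have : {Y : Matrix ι ι ℝ | Y.PosSemidef} =
      {Y | Yᴴ = Y} ∩ ⋂ x : ι → ℝ, {Y | 0 ≤ star x ⬝ᵥ (Y *ᵥ x)} := by
    ext Y
    simp [Matrix.posSemidef_iff_dotProduct_mulVec, Matrix.IsHermitian]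
  rw [this]
  exact (isClosed_eq (by fun_prop) continuous_id).inter
    (isClosed_iInter fun x => isClosed_le continuous_const (by fun_prop))

theorem exists_smul_one_invRiccati_posDef {ι : Type*} [Fintype ι] [DecidableEq ι]
    (A : Matrix ι ι ℝ) {P : Matrix ι ι ℝ} (hP : P.PosDef) :
    ∃ k : ℝ, 0 < k ∧ (invRiccati A P (k • (1 : Matrix ι ι ℝ))).PosDef := by
  cases isEmpty_or_nonempty ι
  · exact ⟨1, one_pos, by rw [Subsingleton.elim (invRiccati _ _ _) 1]; exact .one⟩
  have hA : (Aᵀ + A).IsHermitian := by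
    simp [Matrix.IsHermitian, Matrix.conjTranspose_eq_transpose_of_trivial, add_comm]
  obtain ⟨l, -, -, hl, -⟩ := hA.exists_rayleigh_min hP
  have hk : 0 < |l| + 1 := by positivity
  -- For `k = |l| + 1`, the value is `k((Aᵀ + A - lP) + (l + k)P)` with `l + k ≥ 1`.
  refine ⟨|l| + 1, hk, ?_⟩
  have h1 := (Matrix.PosDef.posSemidef_add hl (hP.smul (a := l + (|l| + 1))
    (by linarith [neg_abs_le l]))).smul hk
  convert h1 using 1
  simp only [invRiccati, Matrix.mul_smul, Matrix.smul_mul, mul_one, one_mul]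
  module

/-- The Riccati equation of an observable pair has a positive definite solution. -/
theorem exists_posDef_invRiccati_eq {ι : Type*} [Fintype ι] [DecidableEq ι] {A P R : Matrix ι ι ℝ}
    (hP : P.PosDef) (hR : R.PosSemidef) (hobs : NoUnobservable A R) :
    ∃ Y : Matrix ι ι ℝ, Y.PosDef ∧ invRiccati A P Y = R := by
  obtain ⟨k, hk, hR₀⟩ := exists_smul_one_invRiccati_posDef A hP
  set R₀ := invRiccati A P (k • (1 : Matrix ι ι ℝ)) with hR₀_def
  let Rs : ℝ → Matrix ι ι ℝ := fun s => (1 - s) • R₀ + s • R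
  have hRs : ∀ s ∈ Set.Icc (0 : ℝ) 1, (Rs s).PosSemidef := fun s hs =>
    (hR₀.posSemidef.smul (sub_nonneg.2 hs.2)).add (hR.smul hs.1)
  have hRsc : Continuous Rs := by fun_prop
  let T : Set ℝ := {s | ∃ Y : Matrix ι ι ℝ, Y.PosSemidef ∧ invRiccati A P Y = Rs s}
  suffices h : Set.Icc (0 : ℝ) 1 ⊆ T by
    obtain ⟨Y, hY, hYR⟩ := h (Set.right_mem_Icc.2 zero_le_one)
    have e : Rs 1 = R := by simp [Rs]
    rw [e] at hYR
    exact ⟨Y, posDef_of_noUnobservable hR hobs hY hYR, hYR⟩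
  refine IsClosed.Icc_subset_of_forall_mem_nhdsWithin ?_ ?_ ?_
  · obtain ⟨b, hb⟩ := exists_bound_of_trace_invRiccati_le A hP (R₀.trace + R.trace)
    let D : Set (ℝ × Matrix ι ι ℝ) :=
      (Set.Icc (0 : ℝ) 1 ×ˢ {Y | ∀ i j, Y i j ∈ Set.Icc (-b) b}) ∩
        {z | z.2.PosSemidef ∧ invRiccati A P z.2 = Rs z.1}
    have hD : IsCompact D := by
      refine (isCompact_Icc.prod isCompact_Icc.matrix).inter_right ?_
      refine (isClosed_setOf_posSemidef.preimage continuous_snd).inter (isClosed_eq ?_ (by fun_prop))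
      unfold invRiccati
      fun_prop
    have hT : T ∩ Set.Icc 0 1 = Prod.fst '' D := by
      ext s
      constructor
      · rintro ⟨⟨Y, hY, hYR⟩, hs⟩
        refine ⟨(s, Y), ⟨⟨hs, hb Y hY.isHermitian ?_⟩, hY, hYR⟩, rfl⟩
        rw [hYR]
        simp only [Rs, Matrix.trace_add, Matrix.trace_smul, smul_eq_mul]
        nlinarith [hR₀.posSemidef.trace_nonneg, hR.trace_nonneg, hs.1, hs.2]
      · rintro ⟨⟨s, Y⟩, ⟨⟨hs, -⟩, hY, hYR⟩, rfl⟩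
        exact ⟨⟨Y, hY, hYR⟩, hs⟩
    rw [hT]
    exact (hD.image continuous_fst).isClosed
  · exact ⟨k • 1, Matrix.PosSemidef.one.smul hk.le, by simp [Rs, hR₀_def]⟩
  · rintro s ⟨⟨Y, hY, hYR⟩, hs⟩
    -- For `s < 1` the term `(1 - s)R₀` keeps `Rs s` definite, so observability is automatic there;
    -- `hobs` is needed only at `s = 1`.
    have hRp : (Rs s).PosDef :=
      (hR₀.smul (sub_pos.2 hs.2)).add_posSemidef (hR.smul hs.1)
    have hYp : Y.PosDef := posDef_of_noUnobservable hRp.posSemidef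
      (fun v hv => Matrix.mulVec_injective_of_isUnit hRp.isUnit
        (by simpa using hv 0)) hY hYR
    obtain ⟨g, -, -, hg⟩ := exists_differentiableAt_local_invRiccati_solution hP hYp
      (hYR ▸ hRp.posSemidef)
    rw [hYR] at hg
    refine mem_nhdsWithin_of_mem_nhds ?_
    filter_upwards [hRsc.continuousAt.eventually hg] with t ht
    obtain ⟨h1, h2⟩ := ht ((hR₀.isHermitian.smul (IsSelfAdjoint.all _)).add
      (hR.isHermitian.smul (IsSelfAdjoint.all _)))
    exact ⟨g (Rs t), h1.posSemidef, h2⟩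

/-! ### Convex minimization on the simplex -/

theorem isCompact_allocSimplex (N : ℕ) (σ : ℝ) : IsCompact (allocSimplex N σ) := by
  have hsub : allocSimplex N σ ⊆ Set.pi Set.univ fun _ => Set.Icc 0 σ := fun v hv i _ =>
    ⟨hv.1 i, hv.2 ▸ Finset.single_le_sum (fun j _ => hv.1 j) (Finset.mem_univ i)⟩
  refine (isCompact_univ_pi fun _ => isCompact_Icc).of_isClosed_subset ?_ hsub
  have : allocSimplex N σ = (⋂ i, {v | 0 ≤ v i}) ∩ {v | ∑ i, v i = σ} := by
    ext v; simp [allocSimplex]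
  rw [this]
  exact (isClosed_iInter fun i => isClosed_le continuous_const (by fun_prop)).inter
    (isClosed_eq (by fun_prop) continuous_const)

theorem convex_allocSimplex (N : ℕ) (σ : ℝ) : Convex ℝ (allocSimplex N σ) := by
  rintro x ⟨hx, hxs⟩ y ⟨hy, hys⟩ a b ha hb hab
  refine ⟨fun i => ?_, ?_⟩
  · have h1 := mul_nonneg ha (hx i)
    have h2 := mul_nonneg hb (hy i)
    simpa using add_nonneg h1 h2
  · simp [Finset.sum_add_distrib, ← Finset.mul_sum, hxs, hys, ← add_mul, hab]

theorem IsUniqueMinimum.of_strictConvexOn {E : Type*} [AddCommGroup E] [Module ℝ E] {f : E → ℝ}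
    {s : Set E} {x : E} (hf : StrictConvexOn ℝ s f) (hx : x ∈ s) (h : IsMinOn f s x) :
    IsUniqueMinimum f s x := by
  refine ⟨hx, fun y hy hyx => (h hy).lt_of_ne fun he => hyx ?_⟩
  refine hf.eq_of_isMinOn (fun z hz => ?_) h hy hx
  rw [Set.mem_ofPred_eq, ← he]
  exact h hz

theorem ConvexOn.fderiv_sub_le {E : Type*} [NormedAddCommGroup E] [NormedSpace ℝ E] {f : E → ℝ}
    {s : Set E} (hf : ConvexOn ℝ s f) {x y : E} (hx : x ∈ s) (hy : y ∈ s)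
    (hd : DifferentiableAt ℝ f x) : fderiv ℝ f x (y - x) ≤ f y - f x := by
  have hc : ConvexOn ℝ (Set.Icc (0 : ℝ) 1) (f ∘ AffineMap.lineMap (k := ℝ) x y) := by
    refine (hf.comp_affineMap (AffineMap.lineMap (k := ℝ) x y)).subset (fun t ht => ?_)
      (convex_Icc _ _)
    exact hf.1.lineMap_mem hx hy ht
  have hd' : HasDerivAt (f ∘ AffineMap.lineMap (k := ℝ) x y) (fderiv ℝ f x (y - x)) 0 := by
    refine HasFDerivAt.comp_hasDerivAt _ ?_ AffineMap.hasDerivAt_lineMap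
    rw [AffineMap.lineMap_apply_zero]
    exact hd.hasFDerivAt
  simpa [slope] using hc.le_slope_of_hasDerivAt (Set.left_mem_Icc.2 zero_le_one)
    (Set.right_mem_Icc.2 zero_le_one) zero_lt_one hd'

theorem partialDerivAt_eq_fderiv {N : ℕ} {f : (Fin N → ℝ) → ℝ} {γ : Fin N → ℝ}
    (hd : DifferentiableAt ℝ f γ) (i : Fin N) :
    partialDerivAt f i γ = fderiv ℝ f γ (Pi.single i 1) := by
  refine HasDerivAt.deriv (HasFDerivAt.comp_hasDerivAt (γ i) ?_ (hasDerivAt_update γ i (γ i)))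
  rw [Function.update_eq_self]
  exact hd.hasFDerivAt

theorem fderiv_eq_sum_partialDerivAt {N : ℕ} {f : (Fin N → ℝ) → ℝ} {γ : Fin N → ℝ}
    (hd : DifferentiableAt ℝ f γ) (v : Fin N → ℝ) :
    fderiv ℝ f γ v = ∑ i, partialDerivAt f i γ * v i := by
  simp only [partialDerivAt_eq_fderiv hd]
  conv_lhs => rw [pi_eq_sum_univ' v]
  simp [map_sum, mul_comm]

/-- First-order conditions for a convex function on the simplex to be minimal. -/
theorem isMinOn_allocSimplex_of_partialDerivAt {N : ℕ} {σ μ : ℝ} {f : (Fin N → ℝ) → ℝ}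
    (hf : ConvexOn ℝ (allocSimplex N σ) f) {γ : Fin N → ℝ} (hγ : γ ∈ allocSimplex N σ)
    (hd : DifferentiableAt ℝ f γ) (h1 : ∀ i, γ i ≠ 0 → partialDerivAt f i γ = μ)
    (h2 : ∀ j, γ j = 0 → μ ≤ partialDerivAt f j γ) : IsMinOn f (allocSimplex N σ) γ := by
  intro y hy
  have h := hf.fderiv_sub_le hγ hy hd
  rw [fderiv_eq_sum_partialDerivAt hd] at h
  have h0 : ∑ i, μ * (y - γ) i ≤ ∑ i, partialDerivAt f i γ * (y - γ) i := by
    refine Finset.sum_le_sum fun i _ => ?_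
    by_cases hi : γ i = 0
    · exact mul_le_mul_of_nonneg_right (h2 i hi) (by simpa [hi] using hy.1 i)
    · rw [h1 i hi]
  have hs : ∑ i, μ * (y - γ) i = 0 := by
    rw [← Finset.mul_sum]
    simp [hy.2, hγ.2]
  rw [Set.mem_ofPred_eq]
  linarith

theorem IsMinOn.partialDerivAt_le {N : ℕ} {σ : ℝ} {f : (Fin N → ℝ) → ℝ} {γ : Fin N → ℝ}
    (h : IsMinOn f (allocSimplex N σ) γ) (hγ : γ ∈ allocSimplex N σ)
    (hd : DifferentiableAt ℝ f γ) {i : Fin N} (hi : γ i ≠ 0) (j : Fin N) :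
    partialDerivAt f i γ ≤ partialDerivAt f j γ := by
  have hpos : 0 < γ i := (hγ.1 i).lt_of_ne' hi
  -- Competitor: transfer the whole mass of coordinate `i` to coordinate `j`.
  set y : Fin N → ℝ := γ + (Pi.single j (γ i) - Pi.single i (γ i)) with hy_def
  have hy : y ∈ allocSimplex N σ := by
    refine ⟨fun k => ?_, ?_⟩
    · have h1 : 0 ≤ (Pi.single j (γ i) : Fin N → ℝ) k := by
        rw [Pi.single_apply]; split_ifs <;> simp [hpos.le]
      have h2 : (Pi.single i (γ i) : Fin N → ℝ) k ≤ γ k := by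
        rw [Pi.single_apply]; split_ifs with hk
        · rw [hk]
        · exact hγ.1 k
      simp only [hy_def, Pi.add_apply, Pi.sub_apply]
      linarith
    · simp [hy_def, Finset.sum_add_distrib, hγ.2]
  have hcone := sub_mem_posTangentConeAt_of_segment_subset
    ((convex_allocSimplex N σ).segment_subset hγ hy)
  rw [hy_def, add_sub_cancel_left] at hcone
  have h0 := h.localize.hasFDerivWithinAt_nonneg hd.hasFDerivAt.hasFDerivWithinAt hcone
  rw [fderiv_eq_sum_partialDerivAt hd] at h0
  simp only [Pi.sub_apply, mul_sub, Finset.sum_sub_distrib,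
    Pi.single_apply, mul_ite, mul_zero, Finset.sum_ite_eq', Finset.mem_univ, if_true] at h0
  exact le_of_mul_le_mul_right (by linarith) hpos

theorem isUniqueMinimum_allocSimplex_iff {N : ℕ} {σ : ℝ} {f : (Fin N → ℝ) → ℝ}
    (hf : StrictConvexOn ℝ (allocSimplex N σ) f) {γ : Fin N → ℝ} (hγ : γ ∈ allocSimplex N σ)
    (hd : DifferentiableAt ℝ f γ) (hneg : ∀ i, partialDerivAt f i γ ≤ 0) :
    IsUniqueMinimum f (allocSimplex N σ) γ ↔
      ∃ μ : ℝ, μ ≤ 0 ∧ (∀ i, γ i ≠ 0 → partialDerivAt f i γ = μ) ∧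
        (∀ j, γ j = 0 → μ ≤ partialDerivAt f j γ) := by
  constructor
  · rintro ⟨-, h⟩
    have hmin : IsMinOn f (allocSimplex N σ) γ := fun y hy => by
      rw [Set.mem_ofPred_eq]
      rcases eq_or_ne y γ with rfl | hne
      · exact le_rfl
      · exact (h y hy hne).le
    by_cases hex : ∃ i, γ i ≠ 0
    · obtain ⟨i, hi⟩ := hex
      exact ⟨partialDerivAt f i γ, hneg i,
        fun j hj => (hmin.partialDerivAt_le hγ hd hj i).antisymm (hmin.partialDerivAt_le hγ hd hi j),
        fun j _ => hmin.partialDerivAt_le hγ hd hi j⟩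
    · push Not at hex
      -- At `γ = 0` any common nonpositive lower bound of the partial derivatives serves as `μ`;
      -- their sum is one, also when `N = 0`.
      exact ⟨∑ i, partialDerivAt f i γ, Finset.sum_nonpos fun i _ => hneg i,
        fun i hi => absurd (hex i) hi, fun j _ => by
          rw [← Finset.add_sum_erase _ _ (Finset.mem_univ j)]
          linarith [Finset.sum_nonpos (s := Finset.univ.erase j) fun i _ => hneg i]⟩
  · rintro ⟨μ, -, h1, h2⟩
    exact .of_strictConvexOn hf hγ (isMinOn_allocSimplex_of_partialDerivAt hf.convexOn hγ hd h1 h2)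

/-! ### Observability Gramians and weak coupling -/

theorem observabilityMatrix_transpose_mul_self {n p : ℕ} (A : Matrix (Fin n) (Fin n) ℝ)
    (c : Matrix (Fin n) (Fin p) ℝ) : (observabilityMatrix A c)ᵀ * observabilityMatrix A c =
      ∑ k ∈ Finset.range n, (A ^ k)ᵀ * (c * cᵀ) * A ^ k := by
  rw [← Fin.sum_univ_eq_sum_range (fun k => (A ^ k)ᵀ * (c * cᵀ) * A ^ k) n]
  ext a b
  rw [Matrix.sum_apply, Matrix.mul_apply, Fintype.sum_prod_type]
  refine Finset.sum_congr rfl fun k _ => ?_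
  rw [show (A ^ (k : ℕ))ᵀ * (c * cᵀ) * A ^ (k : ℕ) = (cᵀ * A ^ (k : ℕ))ᵀ * (cᵀ * A ^ (k : ℕ)) by
    rw [Matrix.transpose_mul, Matrix.transpose_transpose]
    simp only [Matrix.mul_assoc], Matrix.mul_apply]
  rfl

theorem IsObservablePair.det_gramian_ne_zero {n p : ℕ} {A : Matrix (Fin n) (Fin n) ℝ}
    {c : Matrix (Fin n) (Fin p) ℝ} (h : IsObservablePair A c) :
    (∑ k ∈ Finset.range n, (A ^ k)ᵀ * (c * cᵀ) * A ^ k).det ≠ 0 := by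
  rw [← observabilityMatrix_transpose_mul_self, ← isUnit_iff_ne_zero,
    ← Matrix.isUnit_iff_isUnit_det, ← Matrix.mulVec_surjective_iff_isUnit]
  change Function.Surjective (Matrix.mulVecLin _)
  rw [← LinearMap.range_eq_top]
  refine Submodule.eq_top_of_finrank_eq ?_
  rw [← Matrix.rank, Matrix.rank_transpose_mul_self, Module.finrank_fin_fun]
  exact h

theorem IsObservablePair.mul_transpose_ne_zero {n p : ℕ} (hn : 0 < n)
    {A : Matrix (Fin n) (Fin n) ℝ} {c : Matrix (Fin n) (Fin p) ℝ} (h : IsObservablePair A c) :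
    c * cᵀ ≠ 0 := by
  intro h0
  -- For `n = 0` the determinant of the zero matrix is `1`, so positivity of `n` is essential.
  have : Nonempty (Fin n) := ⟨⟨0, hn⟩⟩
  apply h.det_gramian_ne_zero
  simp [h0, Matrix.det_zero]

theorem continuous_networkDrift {N n : ℕ} (A : Fin N → Matrix (Fin n) (Fin n) ℝ)
    (C : Fin N → Fin N → Matrix (Fin n) (Fin n) ℝ) : Continuous (networkDrift A C) := by
  refine continuous_matrix fun x y => ?_
  simp only [networkDrift, Matrix.of_apply]
  split_ifs <;> fun_prop

theorem networkDrift_zero {N n : ℕ} (A : Fin N → Matrix (Fin n) (Fin n) ℝ)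
    (C : Fin N → Fin N → Matrix (Fin n) (Fin n) ℝ) :
    networkDrift A C 0 = Matrix.blockDiagonal A := by
  ext ⟨a, i⟩ ⟨b, j⟩
  simp [networkDrift, Matrix.blockDiagonal_apply]

theorem noUnobservable_of_det_gramian_ne_zero {ι : Type*} [Fintype ι] [DecidableEq ι]
    {A E : Matrix ι ι ℝ} (n : ℕ)
    (h : (∑ k ∈ Finset.range n, (A ^ k)ᵀ * E * A ^ k).det ≠ 0) : NoUnobservable A E := by
  intro v hv
  refine Matrix.eq_zero_of_mulVec_eq_zero h ?_
  rw [Matrix.sum_mulVec]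
  refine Finset.sum_eq_zero fun k _ => ?_
  rw [← Matrix.mulVec_mulVec, ← Matrix.mulVec_mulVec, hv, Matrix.mulVec_zero]

/-- Observability of the network is stable under a small coupling. -/
theorem exists_noUnobservable_networkDrift {N n p : ℕ} {A : Fin N → Matrix (Fin n) (Fin n) ℝ}
    (C : Fin N → Fin N → Matrix (Fin n) (Fin n) ℝ) {c : Fin N → Matrix (Fin n) (Fin p) ℝ}
    (hobs : ∀ i, IsObservablePair (A i) (c i)) :
    ∃ ε₀ : ℝ, 0 < ε₀ ∧ ∀ ε : ℝ, |ε| ≤ ε₀ →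
      NoUnobservable (networkDrift A C ε) (Matrix.blockDiagonal fun i => c i * (c i)ᵀ) := by
  set E : Matrix (Fin n × Fin N) (Fin n × Fin N) ℝ := Matrix.blockDiagonal fun i => c i * (c i)ᵀ
  let M : ℝ → Matrix (Fin n × Fin N) (Fin n × Fin N) ℝ := fun ε =>
    ∑ k ∈ Finset.range n, (networkDrift A C ε ^ k)ᵀ * E * networkDrift A C ε ^ k
  have hA := continuous_networkDrift A C
  have hM : Continuous fun ε => (M ε).det := by fun_prop
  have h0 : (M 0).det ≠ 0 := by
    -- Without coupling, the network Gramian is block diagonal with the subsystem Gramians as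
    -- blocks; continuity of the determinant in `ε` does the rest.
    have e : M 0 = Matrix.blockDiagonal
        (∑ k ∈ Finset.range n, fun i => (A i ^ k)ᵀ * (c i * (c i)ᵀ) * A i ^ k) := by
      rw [← Matrix.blockDiagonalAddMonoidHom_apply, map_sum]
      refine Finset.sum_congr rfl fun k _ => ?_
      rw [Matrix.blockDiagonalAddMonoidHom_apply, Matrix.blockDiagonal_mul, Matrix.blockDiagonal_mul,
        ← Matrix.blockDiagonal_transpose, networkDrift_zero, ← Matrix.blockDiagonal_pow]
      rfl
    rw [e, Matrix.det_blockDiagonal, Finset.prod_ne_zero_iff]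
    intro i _
    rw [Finset.sum_apply]
    exact (hobs i).det_gramian_ne_zero
  obtain ⟨δ, hδ, h⟩ := Metric.eventually_nhds_iff.1 (hM.continuousAt.eventually_ne h0)
  refine ⟨δ / 2, half_pos hδ, fun ε hε => noUnobservable_of_det_gramian_ne_zero n (h ?_)⟩
  rw [Real.dist_eq, sub_zero]
  linarith

/-! ### The network: well-posedness, differentiability, strict convexity -/

/-- The observation term `c_γ c_γᵀ` of the network. -/
def networkGram {N n p : ℕ} (c : Fin N → Matrix (Fin n) (Fin p) ℝ) (rmin : ℝ) (γ : Fin N → ℝ) :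
    Matrix (Fin n × Fin N) (Fin n × Fin N) ℝ :=
  Matrix.blockDiagonal fun i => (γ i + rmin) • (c i * (c i)ᵀ)

section Network

variable {N n p : ℕ} {A : Fin N → Matrix (Fin n) (Fin n) ℝ}
  {C : Fin N → Fin N → Matrix (Fin n) (Fin n) ℝ} {c : Fin N → Matrix (Fin n) (Fin p) ℝ}
  {G : Fin N → Matrix (Fin n) (Fin n) ℝ} {rmin ε : ℝ} {γ : Fin N → ℝ}

theorem networkOutput_mul_transpose (hγ : ∀ i, -rmin < γ i) :
    networkOutput c rmin γ * (networkOutput c rmin γ)ᵀ = networkGram c rmin γ := by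
  rw [networkOutput, Matrix.blockDiagonal_transpose, ← Matrix.blockDiagonal_mul, networkGram]
  congr 1
  funext i
  rw [Matrix.transpose_smul, Matrix.smul_mul, Matrix.mul_smul, smul_smul,
    Real.mul_self_sqrt (by linarith [hγ i])]

theorem posSemidef_networkGram (c : Fin N → Matrix (Fin n) (Fin p) ℝ) (hγ : ∀ i, -rmin < γ i) :
    (networkGram c rmin γ).PosSemidef := by
  rw [← networkOutput_mul_transpose hγ, ← Matrix.conjTranspose_eq_transpose_of_trivial]
  exact Matrix.posSemidef_self_mul_conjTranspose _

theorem isHermitian_networkGram (c : Fin N → Matrix (Fin n) (Fin p) ℝ) (rmin : ℝ) (γ : Fin N → ℝ) :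
    (networkGram c rmin γ).IsHermitian := by
  rw [Matrix.IsHermitian, Matrix.conjTranspose_eq_transpose_of_trivial, networkGram,
    Matrix.blockDiagonal_transpose]
  simp [Matrix.transpose_mul]

theorem networkGram_convexComb (c : Fin N → Matrix (Fin n) (Fin p) ℝ) (γ γ' : Fin N → ℝ) {s t : ℝ}
    (hst : s + t = 1) : networkGram c rmin (s • γ + t • γ') =
      s • networkGram c rmin γ + t • networkGram c rmin γ' := by
  simp only [networkGram, ← Matrix.blockDiagonal_smul, ← Matrix.blockDiagonal_add]
  congr 1
  funext i
  obtain rfl : t = 1 - s := by linarith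
  simp only [Pi.add_apply, Pi.smul_apply, smul_eq_mul]
  module

theorem networkGram_injective (hc : ∀ i, c i * (c i)ᵀ ≠ 0) :
    Function.Injective (networkGram c rmin) := by
  intro γ γ' h
  funext i
  have hi := congrFun (Matrix.blockDiagonal_injective h) i
  simpa using smul_left_injective ℝ (hc i) hi

theorem posSemidef_networkGram_sub (c : Fin N → Matrix (Fin n) (Fin p) ℝ) (rmin : ℝ)
    {γ γ' : Fin N → ℝ} (h : γ ≤ γ') :
    (networkGram c rmin γ' - networkGram c rmin γ).PosSemidef := by
  have e : networkGram c rmin γ' - networkGram c rmin γ =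
      Matrix.blockDiagonal (fun i => √(γ' i - γ i) • c i) *
        (Matrix.blockDiagonal fun i => √(γ' i - γ i) • c i)ᴴ := by
    rw [Matrix.conjTranspose_eq_transpose_of_trivial, Matrix.blockDiagonal_transpose,
      ← Matrix.blockDiagonal_mul, networkGram, networkGram, ← Matrix.blockDiagonal_sub]
    congr 1
    funext i
    rw [Matrix.transpose_smul, Matrix.smul_mul, Matrix.mul_smul, smul_smul,
      Real.mul_self_sqrt (sub_nonneg.2 (h i)), Pi.sub_apply]
    module
  rw [e]
  exact Matrix.posSemidef_self_mul_conjTranspose _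

/-- Rescaling blocks by the nonzero weights `γ i + rmin` does not change the kernel, so one `ε₀`
serves all `γ`. -/
theorem noUnobservable_networkGram {D : Matrix (Fin n × Fin N) (Fin n × Fin N) ℝ}
    (h : NoUnobservable D (Matrix.blockDiagonal fun i => c i * (c i)ᵀ)) (hγ : ∀ i, -rmin < γ i) :
    NoUnobservable D (networkGram c rmin γ) := by
  refine fun v hv => h v fun k => ?_
  have e : Matrix.blockDiagonal (fun i => c i * (c i)ᵀ) =
      Matrix.blockDiagonal (fun i => (γ i + rmin)⁻¹ • (1 : Matrix (Fin n) (Fin n) ℝ)) *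
        networkGram c rmin γ := by
    rw [networkGram, ← Matrix.blockDiagonal_mul]
    congr 1
    funext i
    have : γ i + rmin ≠ 0 := by linarith [hγ i]
    rw [Matrix.smul_mul, one_mul, smul_smul, inv_mul_cancel₀ this, one_smul]
  rw [e, ← Matrix.mulVec_mulVec, hv, Matrix.mulVec_zero]

theorem posDef_network_noise (hG : ∀ i, (G i).det ≠ 0) :
    (Matrix.blockDiagonal G * (Matrix.blockDiagonal G)ᵀ).PosDef := by
  rw [← Matrix.conjTranspose_eq_transpose_of_trivial]
  refine Matrix.PosDef.mul_conjTranspose_self _ ?_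
  rw [Matrix.vecMul_injective_iff_isUnit, Matrix.isUnit_iff_isUnit_det, isUnit_iff_ne_zero,
    Matrix.det_blockDiagonal, Finset.prod_ne_zero_iff]
  exact fun i _ => hG i

theorem isNetworkCovariance_iff (hγ : ∀ i, -rmin < γ i)
    {S : Matrix (Fin n × Fin N) (Fin n × Fin N) ℝ} :
    IsNetworkCovariance A C c G rmin ε γ S ↔ S⁻¹.PosDef ∧ invRiccati (networkDrift A C ε)
      (Matrix.blockDiagonal G * (Matrix.blockDiagonal G)ᵀ) S⁻¹ = networkGram c rmin γ := by
  rw [IsNetworkCovariance, isPosDefRiccatiSolution_iff, networkOutput_mul_transpose hγ]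

theorem existsUnique_isNetworkCovariance (hG : ∀ i, (G i).det ≠ 0)
    (hobs : NoUnobservable (networkDrift A C ε) (Matrix.blockDiagonal fun i => c i * (c i)ᵀ))
    (hγ : ∀ i, -rmin < γ i) : ∃! S, IsNetworkCovariance A C c G rmin ε γ S := by
  have hP := posDef_network_noise hG
  have hR := posSemidef_networkGram c hγ
  obtain ⟨Y, hY, hYR⟩ := exists_posDef_invRiccati_eq hP hR (noUnobservable_networkGram hobs hγ)
  have hYd := (Matrix.isUnit_iff_isUnit_det _).1 hY.isUnit
  refine ⟨Y⁻¹, (isNetworkCovariance_iff hγ).2 ?_, fun S hS => ?_⟩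
  · rw [Matrix.nonsing_inv_nonsing_inv _ hYd]
    exact ⟨hY, hYR⟩
  · obtain ⟨h1, h2⟩ := (isNetworkCovariance_iff hγ).1 hS
    rw [invRiccati_injective hP hY h1 (hYR ▸ hR) (hYR.trans h2.symm),
      Matrix.nonsing_inv_nonsing_inv _ ((Matrix.isUnit_iff_isUnit_det _).1
        (Matrix.posDef_inv_iff.1 h1).isUnit)]

theorem networkCost_eq (hG : ∀ i, (G i).det ≠ 0)
    (hγ : ∀ i, -rmin < γ i) {Y : Matrix (Fin n × Fin N) (Fin n × Fin N) ℝ} (hY : Y.PosDef)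
    (hYR : invRiccati (networkDrift A C ε) (Matrix.blockDiagonal G * (Matrix.blockDiagonal G)ᵀ) Y =
      networkGram c rmin γ) : networkCost A C c G rmin ε γ = Y⁻¹.trace := by
  have hP := posDef_network_noise hG
  have hR := posSemidef_networkGram c hγ
  have hYd := (Matrix.isUnit_iff_isUnit_det _).1 hY.isUnit
  have hex : ∃ S, IsNetworkCovariance A C c G rmin ε γ S := by
    refine ⟨Y⁻¹, (isNetworkCovariance_iff hγ).2 ?_⟩
    rw [Matrix.nonsing_inv_nonsing_inv _ hYd]
    exact ⟨hY, hYR⟩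
  rw [networkCost, networkCovariance, dif_pos hex]
  obtain ⟨h1, h2⟩ := (isNetworkCovariance_iff hγ).1 hex.choose_spec
  rw [invRiccati_injective hP hY h1 (hYR ▸ hR) (hYR.trans h2.symm),
    Matrix.nonsing_inv_nonsing_inv _ ((Matrix.isUnit_iff_isUnit_det _).1
      (Matrix.posDef_inv_iff.1 h1).isUnit)]

theorem exists_posDef_network_solution (hG : ∀ i, (G i).det ≠ 0)
    (hobs : NoUnobservable (networkDrift A C ε) (Matrix.blockDiagonal fun i => c i * (c i)ᵀ))
    (hγ : ∀ i, -rmin < γ i) : ∃ Y : Matrix (Fin n × Fin N) (Fin n × Fin N) ℝ, Y.PosDef ∧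
      invRiccati (networkDrift A C ε) (Matrix.blockDiagonal G * (Matrix.blockDiagonal G)ᵀ) Y =
        networkGram c rmin γ :=
  exists_posDef_invRiccati_eq (posDef_network_noise hG) (posSemidef_networkGram c hγ)
    (noUnobservable_networkGram hobs hγ)

theorem eventually_forall_neg_lt (hγ : ∀ i, -rmin < γ i) :
    ∀ᶠ γ' in 𝓝 γ, ∀ i, -rmin < γ' i :=
  Filter.eventually_all.2 fun i => (continuous_apply i).continuousAt.eventually (lt_mem_nhds (hγ i))

section

attribute [local instance] Matrix.linftyOpNormedRing Matrix.linftyOpNormedAlgebra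

theorem differentiable_networkGram (c : Fin N → Matrix (Fin n) (Fin p) ℝ) (rmin : ℝ) :
    Differentiable ℝ (networkGram c rmin) := by
  have e : networkGram c rmin = fun γ => ∑ i, (γ i + rmin) •
      Matrix.blockDiagonal (Pi.single i (c i * (c i)ᵀ)) := by
    funext γ
    simp only [networkGram, ← Matrix.blockDiagonal_smul]
    simp only [← Matrix.blockDiagonalAddMonoidHom_apply]
    rw [← map_sum]
    congr 1
    funext i
    simp [Finset.sum_apply, Pi.single_apply, Finset.sum_ite_eq]
  rw [e]
  fun_prop

theorem differentiableAt_networkCost (hG : ∀ i, (G i).det ≠ 0)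
    (hobs : NoUnobservable (networkDrift A C ε) (Matrix.blockDiagonal fun i => c i * (c i)ᵀ))
    (hγ : ∀ i, -rmin < γ i) : DifferentiableAt ℝ (networkCost A C c G rmin ε) γ := by
  obtain ⟨Y, hY, hYR⟩ := exists_posDef_network_solution hG hobs hγ
  obtain ⟨g, hg, hgY, hgR⟩ := exists_differentiableAt_local_invRiccati_solution
    (posDef_network_noise hG) hY (hYR ▸ posSemidef_networkGram c hγ)
  rw [hYR] at hg hgY hgR
  have hRd := differentiable_networkGram c rmin γ
  -- By uniqueness of the positive definite solution, the cost coincides near `γ` with this smooth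
  -- local branch.
  have hd : DifferentiableAt ℝ (fun γ' => ((g (networkGram c rmin γ'))⁻¹).trace) γ := by
    simp only [Matrix.nonsing_inv_eq_ringInverse]
    have h1 : DifferentiableAt ℝ (fun γ' => Ring.inverse (g (networkGram c rmin γ'))) γ :=
      (DifferentiableAt.comp γ hg hRd).inverse (by
        rw [Function.comp_apply, hgY]; exact hY.isUnit)
    exact (LinearMap.toContinuousLinearMap
      (Matrix.traceLinearMap (Fin n × Fin N) ℝ ℝ)).differentiableAt.comp γ h1
  refine hd.congr_of_eventuallyEq ?_
  filter_upwards [eventually_forall_neg_lt hγ, hRd.continuousAt.eventually hgR] with γ' h1 h2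
  obtain ⟨h3, h4⟩ := h2 (isHermitian_networkGram c rmin γ')
  exact networkCost_eq hG h1 h3 h4

end

/-- More observation enlarges the inverse solution, hence lowers the trace. This is the source of
the sign of `μ`. -/
theorem networkCost_antitone (hG : ∀ i, (G i).det ≠ 0)
    (hobs : NoUnobservable (networkDrift A C ε) (Matrix.blockDiagonal fun i => c i * (c i)ᵀ))
    (hγ : ∀ i, -rmin < γ i) {γ' : Fin N → ℝ} (h : γ ≤ γ') :
    networkCost A C c G rmin ε γ' ≤ networkCost A C c G rmin ε γ := by
  have hγ' : ∀ i, -rmin < γ' i := fun i => (hγ i).trans_le (h i)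
  obtain ⟨Y, hY, hYR⟩ := exists_posDef_network_solution hG hobs hγ
  obtain ⟨Z, hZ, hZR⟩ := exists_posDef_network_solution hG hobs hγ'
  rw [networkCost_eq hG hγ hY hYR, networkCost_eq hG hγ' hZ hZR]
  refine trace_inv_antitone hY hZ (posSemidef_sub_of_invRiccati (posDef_network_noise hG) hZ
    hY.isHermitian (hZR ▸ posSemidef_networkGram c hγ') ?_)
  rw [hYR, hZR]
  exact posSemidef_networkGram_sub c rmin h

theorem partialDerivAt_networkCost_nonpos (hG : ∀ i, (G i).det ≠ 0)
    (hobs : NoUnobservable (networkDrift A C ε) (Matrix.blockDiagonal fun i => c i * (c i)ᵀ))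
    (hγ : ∀ i, -rmin < γ i) (i : Fin N) :
    partialDerivAt (networkCost A C c G rmin ε) i γ ≤ 0 := by
  have hanti : AntitoneOn (fun t : ℝ => networkCost A C c G rmin ε (Function.update γ i t))
      (Set.Ioi (-rmin)) := by
    intro s hs t _ hst
    refine networkCost_antitone hG hobs (fun j => ?_)
      (update_le_update_iff.2 ⟨hst, fun _ _ => le_rfl⟩)
    rcases eq_or_ne j i with rfl | hj
    · rwa [Function.update_self]
    · rw [Function.update_of_ne hj]; exact hγ j
  rw [partialDerivAt, ← derivWithin_of_isOpen isOpen_Ioi (Set.mem_Ioi.2 (hγ i))]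
  exact hanti.derivWithin_nonpos

theorem strictConvexOn_networkCost (hG : ∀ i, (G i).det ≠ 0) (hc : ∀ i, c i * (c i)ᵀ ≠ 0)
    (hobs : NoUnobservable (networkDrift A C ε) (Matrix.blockDiagonal fun i => c i * (c i)ᵀ)) :
    StrictConvexOn ℝ {γ : Fin N → ℝ | ∀ i, -rmin < γ i} (networkCost A C c G rmin ε) := by
  have hconv : Convex ℝ {γ : Fin N → ℝ | ∀ i, -rmin < γ i} := by
    have : {γ : Fin N → ℝ | ∀ i, -rmin < γ i} = Set.pi Set.univ fun _ => Set.Ioi (-rmin) := by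
      ext; simp
    rw [this]
    exact convex_pi fun _ _ => convex_Ioi _
  refine ⟨hconv, fun γ hγ γ' hγ' hne s t hs ht hst => ?_⟩
  have hm := hconv hγ hγ' hs.le ht.le hst
  have hP := posDef_network_noise hG
  have hR := posSemidef_networkGram c hm
  obtain ⟨Y, hY, hYR⟩ := exists_posDef_network_solution hG hobs hγ
  obtain ⟨Y', hY', hYR'⟩ := exists_posDef_network_solution hG hobs hγ'
  obtain ⟨Z, hZ, hZR⟩ := exists_posDef_network_solution hG hobs hm
  rw [networkCost_eq hG hγ hY hYR, networkCost_eq hG hγ' hY' hYR', networkCost_eq hG hm hZ hZR]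
  refine trace_inv_lt_of_posSemidef_sub_convexComb hY hY' hZ (fun e => hne ?_) hs ht hst
    (posSemidef_sub_convexComb hP hY.isHermitian hY'.isHermitian hZ hs.le ht.le hst (hZR ▸ hR) ?_)
  · subst e
    -- The solution determines its right-hand side, and that determines `γ` because no `c i * (c
    -- i)ᵀ` vanishes; so distinct allocations have distinct solutions.
    exact networkGram_injective hc (hYR.symm.trans hYR')
  · rw [hYR, hYR', hZR, networkGram_convexComb c γ γ' hst]

end Network

theorem theorem1 {N n p : ℕ} (hn : 0 < n)
    (A : Fin N → Matrix (Fin n) (Fin n) ℝ)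
    (C : Fin N → Fin N → Matrix (Fin n) (Fin n) ℝ)
    (c : Fin N → Matrix (Fin n) (Fin p) ℝ)
    (G : Fin N → Matrix (Fin n) (Fin n) ℝ)
    (hobs : ∀ i, IsObservablePair (A i) (c i))
    (hG : ∀ i, (G i).det ≠ 0)
    (hreg : ∀ i, IsRegularTriplet (A i) (c i) (G i * (G i)ᵀ))
    (rmin : ℝ) (hrmin : 0 < rmin) (σ : ℝ) :
    ∃ ε₀ : ℝ, 0 < ε₀ ∧ ∀ ε : ℝ, |ε| ≤ ε₀ →
      -- `Σ(γ)` is well defined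
      (∀ γ : Fin N → ℝ, (∀ i, -rmin < γ i) → ∃! S, IsNetworkCovariance A C c G rmin ε γ S) ∧
      -- the cost is differentiable at the points of the simplex
      (∀ γ ∈ allocSimplex N σ, DifferentiableAt ℝ (networkCost A C c G rmin ε) γ) ∧
      -- the cost is strictly convex over the simplex
      StrictConvexOn ℝ (allocSimplex N σ) (networkCost A C c G rmin ε) ∧
      -- there is one and only one minimizer
      ((allocSimplex N σ).Nonempty →
        ∃ γ, IsUniqueMinimum (networkCost A C c G rmin ε) (allocSimplex N σ) γ) ∧
      -- the minimizer is characterized by the first-order conditions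
      (∀ γ ∈ allocSimplex N σ,
        (IsUniqueMinimum (networkCost A C c G rmin ε) (allocSimplex N σ) γ ↔
          ∃ μ : ℝ, μ ≤ 0 ∧
            (∀ i, γ i ≠ 0 → partialDerivAt (networkCost A C c G rmin ε) i γ = μ) ∧
            (∀ j, γ j = 0 → μ ≤ partialDerivAt (networkCost A C c G rmin ε) j γ))) := by
  obtain ⟨ε₀, hε₀, h⟩ := exists_noUnobservable_networkDrift C hobs
  have hsub : ∀ γ ∈ allocSimplex N σ, ∀ i, -rmin < γ i := fun γ hγ i => by
    linarith [hγ.1 i]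
  refine ⟨ε₀, hε₀, fun ε hε => ?_⟩
  have hO := h ε hε
  have hdiff : ∀ γ ∈ allocSimplex N σ, DifferentiableAt ℝ (networkCost A C c G rmin ε) γ :=
    fun γ hγ => differentiableAt_networkCost hG hO (hsub γ hγ)
  have hconv : StrictConvexOn ℝ (allocSimplex N σ) (networkCost A C c G rmin ε) :=
    (strictConvexOn_networkCost hG (fun i => (hobs i).mul_transpose_ne_zero hn) hO).subset
      (fun γ hγ => hsub γ hγ) (convex_allocSimplex N σ)
  refine ⟨fun γ hγ => existsUnique_isNetworkCovariance hG hO hγ, hdiff, hconv, fun hne => ?_,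
    fun γ hγ => isUniqueMinimum_allocSimplex_iff hconv hγ (hdiff γ hγ) fun i =>
      partialDerivAt_networkCost_nonpos hG hO (hsub γ hγ) i⟩
  obtain ⟨γ, hγ, hmin⟩ := (isCompact_allocSimplex N σ).exists_isMinOn hne
    fun γ hγ => (hdiff γ hγ).continuousAt.continuousWithinAt
  exact ⟨γ, .of_strictConvexOn hconv hγ hmin⟩
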